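/- Let $\lambda$ denote the Liouville function, that is, the completely multiplicative function with $\lambda(p)=-1$ for every prime $p$. Assume the Riemann Hypothesis. Then for every real $\epsilon>0$ there is a constant $C_\epsilon>0$, depending only on $\epsilon$, such that for all real $X>0$ and all $t\in\mathbb{R}$, $$\Bigl|\sum_{X\le n\le 2X}\frac{\lambda(n)}{n^{\frac12+it}}\Bigr|\le C_\epsilon\,(1+|t|)^{\epsilon}X^{\epsilon},$$ where the sum runs over the integers $n$ with $X\le n\le 2X$ (an empty sum being $0$). -/

import Mathlib

/-! For `Re s > 1` the Euler product gives `∑ λ(n) n⁻ˢ = ζ(2s) / ζ(s)`. Under RH the quotient is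
holomorphic on `Re s > 1/2`: the pole of `ζ(2s)` sits on the boundary line and the pole of `ζ`
becomes a zero. The sums to `N` are recovered by Perron's formula, integrating along `Re s = 3/2`.
Moving the line to `Re s = 1/2 + δ` crosses no pole and leaves a power of `N` of order `δ`.

Two estimates make this work. The first is `1/ζ(s) ≪ (1 + |t|)^η` for every `η > 0`, uniformly on
`Re s ≥ 1/2 + δ` (`exists_norm_inv_zetaQuot_le`). The function `(s - 1) ζ(s) / s` grows at most
linearly, so Borel–Carathéodory bounds its logarithm by `O(log |t|)`. Far to the right the logarithm
is bounded, and the three lines theorem between the two improves this to `η log |t| + O(1)`.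

The second is an absolutely convergent Perron integral (`two_pi_mul_sum_eq_integral`). The weight
`(N + 1 - x)₊ - (N - x)₊` equals the indicator of `x ≤ N` at every positive integer, and its kernel
decays like `|z|⁻²`. The sum is therefore exactly an integral, with no truncation error.
Interpolated bounds for the kernel (`norm_perronKernel_le`) lose only `N^δ`. -/

section LiouvilleSums

open Complex Set Filter Topology MeasureTheory

/-! ### Continuation and growth of `(s - 1) ζ(s) / s`, and its size far to the right -/

/-- The fractional part cut off to `(1, ∞)`. -/
noncomputable def fractTail : ℝ → ℂ := indicator (Ioi 1) fun t ↦ ((Int.fract t : ℝ) : ℂ)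

/-- The function `(s - 1) ζ(s) / s`, holomorphic and (under the Riemann hypothesis) nonvanishing
for `1 / 2 < s.re`. -/
noncomputable def zetaQuot (s : ℂ) : ℂ := riemannZeta₁ s / s

lemma norm_fractTail_le (t : ℝ) : ‖fractTail t‖ ≤ 1 := by
  unfold fractTail
  by_cases h : t ∈ Ioi (1 : ℝ)
  · rw [indicator_of_mem h, Complex.norm_real, Real.norm_of_nonneg (Int.fract_nonneg t)]
    exact (Int.fract_lt_one t).le
  · simp [indicator_of_notMem h]

lemma measurable_fractTail : Measurable fractTail :=
  (Complex.measurable_ofReal.comp measurable_fract).indicator measurableSet_Ioi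

lemma mellin_fractTail (s : ℂ) :
    mellin fractTail (-s) = ∫ t in Ioi (1 : ℝ), ((Int.fract t : ℝ) : ℂ) * (t : ℂ) ^ (-(s + 1)) := by
  have h1 : ∀ t : ℝ, (t : ℂ) ^ (-s - 1) • fractTail t =
      (Ioi (1 : ℝ)).indicator (fun t : ℝ ↦ ((Int.fract t : ℝ) : ℂ) * (t : ℂ) ^ (-(s + 1))) t := by
    intro t
    by_cases h : t ∈ Ioi (1 : ℝ)
    · rw [indicator_of_mem h, fractTail, indicator_of_mem h, smul_eq_mul, mul_comm]
      ring_nf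
    · rw [indicator_of_notMem h, fractTail, indicator_of_notMem h, smul_zero]
  simp_rw [mellin, h1]
  rw [setIntegral_indicator measurableSet_Ioi, inter_eq_right.mpr (Ioi_subset_Ioi zero_le_one)]

lemma locallyIntegrableOn_fractTail : LocallyIntegrableOn fractTail (Ioi 0) := by
  apply LocallyIntegrable.locallyIntegrableOn
  apply (locallyIntegrable_const (1 : ℂ)).mono measurable_fractTail.aestronglyMeasurable
  exact Eventually.of_forall fun t ↦ by simpa using norm_fractTail_le t

lemma differentiableAt_mellin_fractTail {s : ℂ} (hs : 0 < s.re) :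
    DifferentiableAt ℂ (fun s ↦ mellin fractTail (-s)) s := by
  have h : DifferentiableAt ℂ (mellin fractTail) (-s) := by
    apply mellin_differentiableAt_of_isBigO_rpow (a := 0) (b := (-s).re - 1)
      locallyIntegrableOn_fractTail
    · refine Asymptotics.IsBigO.of_bound 1 (Eventually.of_forall fun t ↦ ?_)
      simpa using norm_fractTail_le t
    · simpa using hs
    · refine Asymptotics.IsBigO.of_bound 1 ?_
      have : ∀ᶠ t : ℝ in 𝓝[>] 0, t ≤ 1 :=
        (Filter.Tendsto.eventually_le_const zero_lt_one tendsto_id).filter_mono nhdsWithin_le_nhds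
      filter_upwards [this] with t ht
      rw [fractTail, indicator_of_notMem (by simpa using ht)]
      simp only [norm_zero]; positivity
    · simp
  exact h.comp s differentiableAt_id.neg

lemma norm_mellin_fractTail_le {s : ℂ} (hs : 0 < s.re) :
    ‖mellin fractTail (-s)‖ ≤ 1 / s.re := by
  rw [mellin_fractTail]
  have hint : IntegrableOn (fun t : ℝ ↦ t ^ (-(s.re + 1))) (Ioi 1) :=
    integrableOn_Ioi_rpow_of_lt (by linarith) one_pos
  have hval : ∫ t in Ioi (1 : ℝ), t ^ (-(s.re + 1)) = 1 / s.re := by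
    rw [integral_Ioi_rpow_of_lt (by linarith) one_pos]
    simp
  rw [← hval]
  refine norm_integral_le_of_norm_le hint ?_
  filter_upwards [ae_restrict_mem measurableSet_Ioi] with t ht
  have ht0 : (0 : ℝ) < t := lt_trans one_pos ht
  rw [norm_mul, norm_cpow_eq_rpow_re_of_pos ht0, Complex.norm_real,
    Real.norm_of_nonneg (Int.fract_nonneg t)]
  simp only [neg_re, add_re, one_re]
  exact mul_le_of_le_one_left (by positivity) (Int.fract_lt_one t).le

/-- Abel summation gives `ζ(s) = s ∫ ⌊t⌋ t^(-s-1)`; then split `⌊t⌋ = t - {t}`. The `t` part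
produces the pole, and the `{t}` part converges for all `Re s > 0`. -/
lemma riemannZeta₁_eq_of_one_lt_re {s : ℂ} (hs : 1 < s.re) :
    riemannZeta₁ s = s - s * (s - 1) * mellin fractTail (-s) := by
  have hs1 : s ≠ 1 := by rintro rfl; simp at hs
  have hz : riemannZeta s = s * ∫ t in Ioi (1 : ℝ), ((⌊t⌋₊ : ℝ) : ℂ) * (t : ℂ) ^ (-(s + 1)) := by
    rw [← LSeries_one_eq_riemannZeta hs, LSeries_eq_mul_integral (r := 1) 1 zero_le_one hs]
    · simp
    · exact LSeriesSummable_one_iff.mpr hs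
    · refine Asymptotics.IsBigO.of_bound 1 (Eventually.of_forall fun n ↦ ?_)
      simp
  have hsplit : ∫ t in Ioi (1 : ℝ), ((⌊t⌋₊ : ℝ) : ℂ) * (t : ℂ) ^ (-(s + 1)) =
      1 / (s - 1) - mellin fractTail (-s) := by
    have hi1 : IntegrableOn (fun t : ℝ ↦ (t : ℂ) ^ (-s)) (Ioi 1) :=
      integrableOn_Ioi_cpow_of_lt (by simpa using hs) one_pos
    have hi2 : IntegrableOn (fun t : ℝ ↦ ((Int.fract t : ℝ) : ℂ) * (t : ℂ) ^ (-(s + 1)))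
        (Ioi 1) := by
      have hb : IntegrableOn (fun t : ℝ ↦ (t : ℂ) ^ (-(s + 1))) (Ioi 1) :=
        integrableOn_Ioi_cpow_of_lt (by simp; linarith) one_pos
      refine hb.bdd_mul (c := 1) ?_ ?_
      · exact (Complex.measurable_ofReal.comp measurable_fract).aestronglyMeasurable
      · refine Eventually.of_forall fun t ↦ ?_
        rw [Complex.norm_real, Real.norm_of_nonneg (Int.fract_nonneg t)]
        exact (Int.fract_lt_one t).le
    have h1 : ∫ t in Ioi (1 : ℝ), (t : ℂ) ^ (-s) = 1 / (s - 1) := by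
      rw [integral_Ioi_cpow_of_lt (by simpa using hs) one_pos]
      have : -s + 1 ≠ 0 := by grind
      have : s - 1 ≠ 0 := by grind
      simp only [ofReal_one, one_cpow]
      grind
    rw [mellin_fractTail, ← h1, ← integral_sub hi1 hi2]
    refine setIntegral_congr_fun measurableSet_Ioi fun t ht ↦ ?_
    have ht0 : (0 : ℝ) < t := lt_trans one_pos ht
    have hfl : ((⌊t⌋₊ : ℝ) : ℂ) = t - ((Int.fract t : ℝ) : ℂ) := by
      rw [← Complex.ofReal_sub, Int.self_sub_fract, natCast_floor_eq_intCast_floor ht0.le]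
    have hpow : (t : ℂ) ^ (-s) = t * (t : ℂ) ^ (-(s + 1)) := by
      have ht' : (t : ℂ) ≠ 0 := by exact_mod_cast ht0.ne'
      rw [neg_add, cpow_add _ _ ht', cpow_neg_one]
      field_simp
    simp only [hfl, hpow]
    ring
  have h0 : s - 1 ≠ 0 := sub_ne_zero.mpr hs1
  have h2 : riemannZeta₁ s = (s - 1) * riemannZeta s := by
    rw [riemannZeta_eq_inv_sub_mul hs1]; field_simp
  rw [h2, hz, hsplit]
  field_simp

/-- Identity theorem: both sides are analytic on the right half-plane and agree near `2`. -/
lemma riemannZeta₁_eq {s : ℂ} (hs : 0 < s.re) :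
    riemannZeta₁ s = s - s * (s - 1) * mellin fractTail (-s) := by
  have hU : IsOpen {s : ℂ | 0 < s.re} := isOpen_re_gt 0
  have hf : AnalyticOnNhd ℂ riemannZeta₁ {s : ℂ | 0 < s.re} :=
    differentiable_riemannZeta₁.differentiableOn.analyticOnNhd hU
  have hg : AnalyticOnNhd ℂ (fun s ↦ s - s * (s - 1) * mellin fractTail (-s))
      {s : ℂ | 0 < s.re} := by
    refine DifferentiableOn.analyticOnNhd (fun z hz ↦ ?_) hU
    have := differentiableAt_mellin_fractTail hz
    exact DifferentiableAt.differentiableWithinAt (by fun_prop)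
  refine hf.eqOn_of_preconnected_of_eventuallyEq hg
    (convex_halfSpace_re_gt 0).isPreconnected (z₀ := 2) (by simp) ?_ hs
  filter_upwards [(isOpen_re_gt 1).mem_nhds (show (2 : ℂ) ∈ {s : ℂ | 1 < s.re} by simp)] with z hz
  exact riemannZeta₁_eq_of_one_lt_re hz

lemma norm_zetaQuot_le {s : ℂ} (hs : 1 / 2 < s.re) : ‖zetaQuot s‖ ≤ 1 + 2 * ‖s - 1‖ := by
  have h0 : 0 < s.re := by linarith
  have hs0 : s ≠ 0 := by rintro rfl; simp at h0
  have h1 : zetaQuot s = 1 - (s - 1) * mellin fractTail (-s) := by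
    rw [zetaQuot, riemannZeta₁_eq h0]; field_simp
  rw [h1]
  have h2 : ‖mellin fractTail (-s)‖ ≤ 2 := by
    refine (norm_mellin_fractTail_le h0).trans ?_
    rw [div_le_iff₀ h0]; linarith
  calc _ ≤ ‖(1 : ℂ)‖ + ‖(s - 1) * mellin fractTail (-s)‖ := norm_sub_le _ _
    _ ≤ 1 + 2 * ‖s - 1‖ := by
      rw [norm_one, norm_mul, mul_comm 2]; gcongr

lemma differentiableAt_zetaQuot {s : ℂ} (hs : s ≠ 0) : DifferentiableAt ℂ zetaQuot s := by
  unfold zetaQuot; fun_prop (disch := assumption)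

lemma zetaQuot_eq {s : ℂ} (hs : s ≠ 1) : zetaQuot s = (s - 1) * riemannZeta s / s := by
  have h0 : s - 1 ≠ 0 := sub_ne_zero.mpr hs
  rw [zetaQuot, riemannZeta_eq_inv_sub_mul hs]; field_simp

lemma zetaQuot_ne_zero (hRH : RiemannHypothesis) {s : ℂ} (hs : 1 / 2 < s.re) : zetaQuot s ≠ 0 := by
  have hs0 : s ≠ 0 := by rintro rfl; norm_num at hs
  by_cases h1 : s = 1
  · subst h1; simp [zetaQuot]
  rw [zetaQuot_eq h1]
  refine div_ne_zero (mul_ne_zero (sub_ne_zero.mpr h1) fun hz ↦ ?_) hs0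
  have := hRH s hz ?_ h1
  · linarith
  · rintro ⟨n, rfl⟩
    simp at hs
    linarith [(Nat.cast_nonneg n : (0 : ℝ) ≤ n)]

/-- Removing the term `n = 1` leaves a series dominated termwise by its value at the real point `σ`.
-/
lemma norm_riemannZeta_sub_one_le {s : ℂ} {σ : ℝ} (hσ : 1 < σ) (hs : σ ≤ s.re) :
    ‖riemannZeta s - 1‖ ≤ ‖riemannZeta σ‖ - 1 := by
  have hs1 : 1 < s.re := by linarith
  have hsum : ∀ z : ℂ, 1 < z.re → Summable fun n : ℕ ↦ 1 / ((n : ℂ) + 1) ^ z := fun z hz ↦ by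
    have := (summable_nat_add_iff 1).mpr (Complex.summable_one_div_nat_cpow.mpr hz)
    simpa using this
  have key : ∀ z : ℂ, 1 < z.re → riemannZeta z - 1 = ∑' n : ℕ, 1 / ((n : ℂ) + 2) ^ z := by
    intro z hz
    rw [zeta_eq_tsum_one_div_nat_add_one_cpow hz, (hsum z hz).tsum_eq_zero_add]
    simp only [Nat.cast_zero, zero_add, one_cpow, div_one, add_sub_cancel_left]
    congr with n
    push_cast; ring_nf
  have hn : ∀ (z : ℂ) (n : ℕ), ‖1 / ((n : ℂ) + 2) ^ z‖ = 1 / ((n : ℝ) + 2) ^ z.re := by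
    intro z n
    have : ((n : ℂ) + 2) = (((n : ℝ) + 2 : ℝ) : ℂ) := by push_cast; rfl
    rw [norm_div, norm_one, this, norm_cpow_eq_rpow_re_of_pos (by positivity)]
  have hsumn : Summable fun n : ℕ ↦ 1 / ((n : ℝ) + 2) ^ σ := by
    have := (summable_nat_add_iff 2).mpr (Real.summable_one_div_nat_rpow.mpr hσ)
    simpa using this
  have hreal : riemannZeta σ - 1 = ((∑' n : ℕ, 1 / ((n : ℝ) + 2) ^ σ : ℝ) : ℂ) := by
    rw [key σ (by simpa using hσ), Complex.ofReal_tsum]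
    congr with n
    push_cast [Complex.ofReal_cpow (show (0 : ℝ) ≤ n + 2 by positivity)]
    rfl
  have hnonneg : 0 ≤ ∑' n : ℕ, 1 / ((n : ℝ) + 2) ^ σ := tsum_nonneg fun n ↦ by positivity
  have hnorm : ‖riemannZeta σ‖ - 1 = ∑' n : ℕ, 1 / ((n : ℝ) + 2) ^ σ := by
    have : riemannZeta σ = ((1 + ∑' n : ℕ, 1 / ((n : ℝ) + 2) ^ σ : ℝ) : ℂ) := by
      rw [Complex.ofReal_add, ← hreal]; simp
    rw [this, Complex.norm_real, Real.norm_of_nonneg (by positivity)]; ring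
  rw [key s hs1, hnorm]
  refine tsum_of_norm_bounded hsumn.hasSum fun n ↦ ?_
  rw [hn]
  gcongr
  linarith [(Nat.cast_nonneg n : (0 : ℝ) ≤ n)]

lemma norm_riemannZeta_le {s : ℂ} {σ : ℝ} (hσ : 1 < σ) (hs : σ ≤ s.re) :
    ‖riemannZeta s‖ ≤ ‖riemannZeta σ‖ := by
  have h := norm_riemannZeta_sub_one_le hσ hs
  have := norm_le_norm_sub_add (riemannZeta s) 1
  rw [norm_one] at this
  linarith

/-- Keeps `zetaQuot` in the domain of the principal logarithm. As `ζ(4) = π⁴/90 ≤ 1.1`, the two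
errors `ζ - 1` and `ζ/s` total at most `0.1 + 1.1/4`. -/
lemma norm_zetaQuot_sub_one_le {s : ℂ} (hs : 4 ≤ s.re) : ‖zetaQuot s - 1‖ ≤ 1 / 2 := by
  have hs1 : s ≠ 1 := by rintro rfl; norm_num at hs
  have hs0 : s ≠ 0 := by rintro rfl; norm_num at hs
  have hn : 4 ≤ ‖s‖ := hs.trans (re_le_norm s)
  have h4 : ‖riemannZeta ((4 : ℝ) : ℂ)‖ ≤ 1.1 := by
    rw [ofReal_ofNat, riemannZeta_four]
    have : (Real.pi : ℂ) ^ 4 / 90 = ((Real.pi ^ 4 / 90 : ℝ) : ℂ) := by push_cast; rfl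
    rw [this, Complex.norm_real, Real.norm_of_nonneg (by positivity)]
    have : Real.pi ^ 4 ≤ 3.15 ^ 4 := by gcongr; exact Real.pi_lt_d2.le
    norm_num at this ⊢
    linarith
  have hz := norm_riemannZeta_sub_one_le (by norm_num) hs
  have hz' := norm_riemannZeta_le (by norm_num) hs
  have hq : zetaQuot s - 1 = (riemannZeta s - 1) - riemannZeta s / s := by
    rw [zetaQuot_eq hs1]; field_simp; ring
  rw [hq]
  refine (norm_sub_le _ _).trans ?_
  rw [norm_div]
  have : ‖riemannZeta s‖ / ‖s‖ ≤ 1.1 / 4 := by gcongr; exact hz'.trans h4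
  norm_num at h4 hz this ⊢
  linarith

/-! ### Logarithm of `zetaQuot` and the bound for its inverse under RH -/

/-- A nonvanishing holomorphic function on a nonempty convex open set has a holomorphic logarithm. -/
lemma exists_differentiableOn_exp_eq {U : Set ℂ} (hU : IsOpen U) (hc : Convex ℝ U)
    (hne : U.Nonempty) {f : ℂ → ℂ} (hf : DifferentiableOn ℂ f U) (h0 : ∀ s ∈ U, f s ≠ 0) :
    ∃ L : ℂ → ℂ, DifferentiableOn ℂ L U ∧ ∀ s ∈ U, exp (L s) = f s := by
  have := hc.contractibleSpace hne
  have hsc : IsSimplyConnected U := (inferInstance : SimplyConnectedSpace U)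
  obtain ⟨L, hLc, hL⟩ := exists_continuousOn_eqOn_exp_comp hsc hU
    hf.continuousOn (by rintro ⟨s, hs, h⟩; exact h0 s hs h)
  have hL' : ∀ s ∈ U, exp (L s) = f s := fun s hs ↦ hL hs
  refine ⟨L, fun s hs ↦ ?_, hL'⟩
  have hUn : U ∈ 𝓝 s := hU.mem_nhds hs
  have hcont : ContinuousAt L s := hLc.continuousAt hUn
  have hball : ∀ᶠ z in 𝓝 s, ‖L z - L s‖ < 1 := by
    have : Tendsto (fun z ↦ ‖L z - L s‖) (𝓝 s) (𝓝 0) := by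
      have := (hcont.sub (continuousAt_const (y := L s))).norm
      simpa [ContinuousAt] using this
    exact this.eventually_lt_const one_pos
  -- Near `s` the continuous logarithm differs from `L s` by less than `π` in imaginary part, so the
  -- difference is the principal logarithm of `f z / f s`, which is holomorphic.
  have heq : L =ᶠ[𝓝 s] fun z ↦ L s + log (f z / f s) := by
    filter_upwards [hball, hUn] with z hz hzU
    have him : |(L z - L s).im| < 1 := (abs_im_le_norm _).trans_lt hz
    rw [abs_lt] at him
    rw [← hL' z hzU, ← hL' s hs, ← exp_sub, log_exp]
    · ring
    · linarith [Real.pi_gt_three]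
    · linarith [Real.pi_gt_three]
  refine (DifferentiableAt.congr_of_eventuallyEq ?_ heq).differentiableWithinAt
  have hfd : DifferentiableAt ℂ f s := hf.differentiableAt hUn
  refine (differentiableAt_const _).add (DifferentiableAt.clog (hfd.div_const _) ?_)
  rw [div_self (h0 s hs)]
  exact one_mem_slitPlane

/-- The bound on `Re s ≥ 5` comes from comparison with the principal logarithm: on `Re s > 4` the
difference `D` satisfies `exp D = 1`, hence has zero derivative and is constant. -/
lemma exists_log_zetaQuot (hRH : RiemannHypothesis) :
    ∃ L : ℂ → ℂ, DifferentiableOn ℂ L {s | 1 / 2 < s.re} ∧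
      (∀ s : ℂ, 1 / 2 < s.re → exp (L s) = zetaQuot s) ∧
      ∃ C : ℝ, 1 ≤ C ∧ ∀ s : ℂ, 5 ≤ s.re → ‖L s‖ ≤ C := by
  have hU : IsOpen {s : ℂ | 1 / 2 < s.re} := isOpen_re_gt _
  have hne : ∀ s : ℂ, 1 / 2 < s.re → s ≠ 0 := by rintro s hs rfl; norm_num at hs
  have hG : DifferentiableOn ℂ zetaQuot {s | 1 / 2 < s.re} := fun s hs ↦
    (differentiableAt_zetaQuot (hne s hs)).differentiableWithinAt
  obtain ⟨L, hLd, hL⟩ := exists_differentiableOn_exp_eq hU (convex_halfSpace_re_gt _)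
    ⟨1, by norm_num⟩ hG fun s hs ↦ zetaQuot_ne_zero hRH hs
  refine ⟨L, hLd, hL, ?_⟩
  have hV : IsOpen {s : ℂ | 4 < s.re} := isOpen_re_gt _
  have hVU : ∀ s : ℂ, 4 < s.re → 1 / 2 < s.re := fun s hs ↦ by linarith
  have hslit : ∀ s : ℂ, 4 < s.re → zetaQuot s ∈ slitPlane := by
    intro s hs
    refine ball_one_subset_slitPlane ?_
    rw [mem_ball_iff_norm]
    exact (norm_zetaQuot_sub_one_le hs.le).trans_lt (by norm_num)
  set D : ℂ → ℂ := fun s ↦ L s - log (zetaQuot s) with hD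
  have hDd : DifferentiableOn ℂ D {s : ℂ | 4 < s.re} := fun s hs ↦ by
    refine DifferentiableAt.differentiableWithinAt ?_
    exact (hLd.differentiableAt (hU.mem_nhds (hVU s hs))).sub
      ((differentiableAt_zetaQuot (hne s (hVU s hs))).clog (hslit s hs))
  have hDexp : ∀ s : ℂ, 4 < s.re → exp (D s) = 1 := by
    intro s hs
    have h0 := zetaQuot_ne_zero hRH (hVU s hs)
    rw [hD, exp_sub, hL s (hVU s hs), exp_log h0, div_self h0]
  have hDder : EqOn (deriv D) 0 {s : ℂ | 4 < s.re} := by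
    intro s hs
    have h1 : HasDerivAt (fun z ↦ exp (D z)) (exp (D s) * deriv D s) s :=
      (hDd.differentiableAt (hV.mem_nhds hs)).hasDerivAt.cexp
    have h2 : HasDerivAt (fun z ↦ exp (D z)) 0 s := by
      refine (hasDerivAt_const s (1 : ℂ)).congr_of_eventuallyEq ?_
      filter_upwards [hV.mem_nhds hs] with z hz using hDexp z hz
    have := h1.unique h2
    rw [hDexp s hs, one_mul] at this
    exact this
  have hconst : ∀ s : ℂ, 4 < s.re → D s = D 5 := fun s hs ↦
    hV.is_const_of_deriv_eq_zero (convex_halfSpace_re_gt _).isPreconnected hDd hDder hs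
      (show (4 : ℝ) < (5 : ℂ).re by norm_num)
  refine ⟨1 + ‖D 5‖, by linarith [norm_nonneg (D 5)], fun s hs ↦ ?_⟩
  have hs4 : 4 < s.re := by linarith
  have hlog : ‖log (zetaQuot s)‖ ≤ 1 := by
    have h := norm_zetaQuot_sub_one_le hs4.le
    have := norm_log_one_add_half_le_self h
    rw [add_sub_cancel] at this
    linarith
  have : L s = log (zetaQuot s) + D 5 := by rw [← hconst s hs4, hD]; ring
  rw [this]
  exact (norm_add_le _ _).trans (by gcongr)

/-- Borel–Carathéodory on the disc centred at `5 + i Im s` of radius `9/2`, which just touches `Re =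
1/2`. There `Re L = log |zetaQuot|`, at most the logarithm of `1 + 2(4 + |Im s| + 9/2) ≤ 2|Im s| +
21`. -/
lemma norm_log_zetaQuot_le {L : ℂ → ℂ} (hLd : DifferentiableOn ℂ L {s | 1 / 2 < s.re})
    (hL : ∀ s : ℂ, 1 / 2 < s.re → exp (L s) = zetaQuot s) {C : ℝ} (hC : 1 ≤ C)
    (hLC : ∀ s : ℂ, 5 ≤ s.re → ‖L s‖ ≤ C) {δ : ℝ} (hδ : 0 < δ) {s : ℂ}
    (hs : 1 / 2 + δ ≤ s.re) (hs' : s.re ≤ 5) :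
    ‖L s‖ ≤ 9 * (1 + C) / δ * Real.log (2 * |s.im| + 21) := by
  set c : ℂ := ⟨5, s.im⟩ with hc
  set M : ℝ := Real.log (2 * |s.im| + 21) with hM
  have hM1 : 1 ≤ M := by
    rw [hM, Real.le_log_iff_exp_le (by positivity)]
    have := Real.exp_one_lt_d9
    linarith [abs_nonneg s.im]
  have hmem : ∀ z ∈ Metric.ball (0 : ℂ) (9 / 2), 1 / 2 < (c + z).re := by
    intro z hz
    rw [mem_ball_zero_iff] at hz
    have := (abs_le.mp ((abs_re_le_norm z).trans hz.le)).1
    have h2 : |z.re| < 9 / 2 := (abs_re_le_norm z).trans_lt hz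
    simp only [add_re, hc]
    linarith [(abs_lt.mp h2).1]
  have hf : DifferentiableOn ℂ (fun z ↦ L (c + z)) (Metric.ball 0 (9 / 2)) :=
    hLd.comp (by fun_prop) hmem
  have hf1 : MapsTo (fun z ↦ L (c + z)) (Metric.ball 0 (9 / 2)) {z | z.re ≤ M} := by
    intro z hz
    have h1 := hmem z hz
    rw [mem_ball_zero_iff] at hz
    change (L (c + z)).re ≤ M
    have h2 : Real.exp (L (c + z)).re = ‖zetaQuot (c + z)‖ := by rw [← hL _ h1, norm_exp]
    rw [hM, Real.le_log_iff_exp_le (by positivity), h2]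
    refine (norm_zetaQuot_le h1).trans ?_
    have h3 : ‖c - 1‖ ≤ 4 + |s.im| := by
      refine (norm_le_abs_re_add_abs_im _).trans ?_
      simp only [hc, sub_re, one_re, sub_im, one_im, sub_zero]
      norm_num
    have h4 : ‖c + z - 1‖ ≤ ‖c - 1‖ + ‖z‖ := by
      rw [show c + z - 1 = (c - 1) + z by ring]; exact norm_add_le _ _
    linarith
  have hz : s - c = ((s.re - 5 : ℝ) : ℂ) := by
    apply Complex.ext <;> simp [hc]
  have hzn : ‖s - c‖ = 5 - s.re := by
    rw [hz, Complex.norm_real, Real.norm_of_nonpos (by linarith)]; ring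
  have hzb : s - c ∈ Metric.ball (0 : ℂ) (9 / 2) := by
    rw [mem_ball_zero_iff, hzn]; linarith
  have hbc := borelCaratheodory (by linarith) hf hf1 (by norm_num) hzb
  simp only [add_sub_cancel, add_zero, hzn] at hbc
  have hcC : ‖L c‖ ≤ C := hLC c (by simp [hc])
  have hden : δ ≤ 9 / 2 - (5 - s.re) := by linarith
  calc ‖L s‖ ≤ _ := hbc
    _ ≤ 2 * M * (9 / 2) / δ + C * 9 / δ := by
      gcongr <;> linarith
    _ = 9 * (M + C) / δ := by ring
    _ ≤ 9 * ((1 + C) * M) / δ := by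
      gcongr; nlinarith
    _ = _ := by ring

/-- Weighted AM-GM for `η a` and `η^(-1/θ₀) b`, whose weighted geometric mean only exceeds that of
`a` and `b`. It turns a three lines bound into a small multiple of `a` plus a constant multiple of
`b`. -/
lemma rpow_mul_rpow_le_mul_add {a b η θ₀ θ : ℝ} (ha : 0 ≤ a) (hb : 0 ≤ b) (hη : 0 < η)
    (hη1 : η ≤ 1) (hθ₀ : 0 < θ₀) (hθ : θ₀ ≤ θ) (hθ1 : θ ≤ 1) :
    a ^ (1 - θ) * b ^ θ ≤ η * a + η ^ (-(1 / θ₀)) * b := by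
  have hq : 0 < η ^ (-(1 / θ₀)) := by positivity
  have h := Real.geom_mean_le_arith_mean2_weighted (sub_nonneg.mpr hθ1) (hθ₀.le.trans hθ)
    (mul_nonneg hη.le ha) (mul_nonneg hq.le hb) (by ring)
  have h1 : (η * a) ^ (1 - θ) * (η ^ (-(1 / θ₀)) * b) ^ θ =
      η ^ ((1 - θ) + -(1 / θ₀) * θ) * (a ^ (1 - θ) * b ^ θ) := by
    rw [Real.mul_rpow hη.le ha, Real.mul_rpow hq.le hb, ← Real.rpow_mul hη.le,
      Real.rpow_add hη]
    ring
  have h2 : 1 ≤ η ^ ((1 - θ) + -(1 / θ₀) * θ) := by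
    apply Real.one_le_rpow_of_pos_of_le_one_of_nonpos hη hη1
    have : 1 ≤ 1 / θ₀ * θ := by
      rw [one_div, inv_mul_eq_div, le_div_iff₀ hθ₀]; linarith
    linarith
  calc a ^ (1 - θ) * b ^ θ ≤ (η * a) ^ (1 - θ) * (η ^ (-(1 / θ₀)) * b) ^ θ := by
        rw [h1]; exact le_mul_of_one_le_left (by positivity) h2
    _ ≤ _ := h
    _ ≤ _ := add_le_add (mul_le_of_le_one_left (by positivity) (by linarith))
      (mul_le_of_le_one_left (by positivity) hθ1)

open HadamardThreeLines in
/-- On vertical lines to the right of `1 / 2` the logarithm of `zetaQuot` is `o(log |t|)`. -/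
lemma exists_norm_log_zetaQuot_le {L : ℂ → ℂ} (hLd : DifferentiableOn ℂ L {s | 1 / 2 < s.re})
    (hL : ∀ s : ℂ, 1 / 2 < s.re → exp (L s) = zetaQuot s) {C : ℝ} (hC : 1 ≤ C)
    (hLC : ∀ s : ℂ, 5 ≤ s.re → ‖L s‖ ≤ C) {δ : ℝ} (hδ : 0 < δ) (hδ1 : δ ≤ 1) {η : ℝ}
    (hη : 0 < η) :
    ∃ B : ℝ, ∀ s : ℂ, 1 / 2 + δ ≤ s.re → s.re ≤ 5 →
      ‖L s‖ ≤ η * Real.log (2 * |s.im| + 21) + B := by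
  set A : ℝ := 9 * (1 + C) / (δ / 2) with hA
  have hA0 : 0 < A := by positivity
  set K : ℝ := 2 * Real.exp 25 * A with hK
  have hK0 : 0 < K := by positivity
  set η' : ℝ := min 1 (η / K) with hη'
  have hη'0 : 0 < η' := by positivity
  set l : ℝ := 1 / 2 + δ / 2 with hl
  have hl5 : l < 5 := by linarith
  -- Lower bound for the interpolation weight at `5`: `s.re` is at least `δ/2` from the left edge
  -- `l` of a strip of width below `5`.
  set θ₀ : ℝ := δ / 10 with hθ₀
  refine ⟨η' ^ (-(1 / θ₀)) * (Real.exp 25 * C), fun s hs hs5 ↦ ?_⟩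
  set ℓ : ℝ := Real.log (2 * |s.im| + 21) with hℓ
  have hℓ1 : 1 ≤ ℓ := by
    rw [hℓ, Real.le_log_iff_exp_le (by positivity)]
    have := Real.exp_one_lt_d9
    linarith [abs_nonneg s.im]
  -- Recentring at height `Im s` and damping by `exp (z ^ 2)` makes `h` bounded on the strip, as
  -- three lines requires. At the real point `s.re` the damping factor has norm at least `1`, so
  -- nothing is lost.
  set h : ℂ → ℂ := fun z ↦ L (z + s.im * I) * exp (z ^ 2) with hh
  have hre : ∀ z : ℂ, (z + s.im * I).re = z.re := fun z ↦ by simp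
  have him : ∀ z : ℂ, (z + s.im * I).im = z.im + s.im := fun z ↦ by simp
  have hexp : ∀ z : ℂ, l ≤ z.re → z.re ≤ 5 →
      ‖exp (z ^ 2)‖ ≤ Real.exp 25 * Real.exp (-z.im ^ 2) := by
    intro z h1 h2
    rw [norm_exp, ← Real.exp_add, Real.exp_le_exp, pow_two, mul_re]
    nlinarith
  have hbd : ∀ z : ℂ, l ≤ z.re → z.re ≤ 5 → ‖h z‖ ≤ K * ℓ := by
    intro z h1 h2
    have hL1 : ‖L (z + s.im * I)‖ ≤ A * (ℓ * (1 + 2 * |z.im|)) := by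
      refine (norm_log_zetaQuot_le hLd hL hC hLC (half_pos hδ) (by rw [hre]; exact h1)
        (by rw [hre]; exact h2)).trans ?_
      rw [him]
      gcongr
      have hpos : (0 : ℝ) < 2 * |s.im| + 21 := by positivity
      have hle : 2 * |z.im + s.im| + 21 ≤ (2 * |s.im| + 21) * (1 + 2 * |z.im|) := by
        have := abs_add_le z.im s.im
        nlinarith [abs_nonneg z.im, abs_nonneg s.im, mul_nonneg (abs_nonneg z.im) (abs_nonneg s.im)]
      calc Real.log (2 * |z.im + s.im| + 21)
          ≤ Real.log ((2 * |s.im| + 21) * (1 + 2 * |z.im|)) :=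
            Real.log_le_log (by positivity) hle
        _ = ℓ + Real.log (1 + 2 * |z.im|) := Real.log_mul hpos.ne' (by positivity)
        _ ≤ ℓ + 2 * |z.im| := by
          have := Real.log_le_sub_one_of_pos (show 0 < 1 + 2 * |z.im| by positivity)
          linarith
        _ ≤ ℓ * (1 + 2 * |z.im|) := by nlinarith [abs_nonneg z.im]
    have hg : (1 + 2 * |z.im|) * Real.exp (-z.im ^ 2) ≤ 2 := by
      rw [Real.exp_neg, ← div_eq_mul_inv, div_le_iff₀ (Real.exp_pos _)]
      have := Real.add_one_le_exp (z.im ^ 2)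
      nlinarith [sq_nonneg (|z.im| - 1), sq_abs z.im]
    calc ‖h z‖ = ‖L (z + s.im * I)‖ * ‖exp (z ^ 2)‖ := norm_mul _ _
      _ ≤ A * (ℓ * (1 + 2 * |z.im|)) * (Real.exp 25 * Real.exp (-z.im ^ 2)) := by
        gcongr; exact hexp z h1 h2
      _ = Real.exp 25 * A * ℓ * ((1 + 2 * |z.im|) * Real.exp (-z.im ^ 2)) := by ring
      _ ≤ Real.exp 25 * A * ℓ * 2 := by gcongr
      _ = K * ℓ := by rw [hK]; ring
  have hd : DifferentiableOn ℂ h {z : ℂ | 1 / 2 < z.re} := by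
    refine DifferentiableOn.mul (hLd.comp (by fun_prop) fun z hz ↦ ?_) (by fun_prop)
    change 1 / 2 < (z + s.im * I).re
    rw [hre]; exact hz
  have hsub : verticalClosedStrip l 5 ⊆ {z : ℂ | 1 / 2 < z.re} := by
    intro z hz
    have : l ≤ z.re := hz.1
    change 1 / 2 < z.re
    linarith
  have hcl : DiffContOnCl ℂ h (verticalStrip l 5) := by
    refine (hd.mono ?_).diffContOnCl
    refine (closure_minimal (fun z hz ↦ ?_) ?_).trans hsub
    · exact ⟨hz.1.le, hz.2.le⟩
    · exact isClosed_Icc.preimage continuous_re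
  have hz0 : ((s.re : ℝ) : ℂ) ∈ verticalClosedStrip l 5 := by
    refine ⟨?_, ?_⟩
    · simp only [ofReal_re]; linarith
    · simpa using hs5
  have h3 := norm_le_interp_of_mem_verticalClosedStrip' (a := K * ℓ) (b := Real.exp 25 * C)
    hl5 hz0 hcl ?_ ?_ ?_
  · have hval : ‖L s‖ ≤ ‖h s.re‖ := by
      have e : ((s.re : ℝ) : ℂ) + s.im * I = s := re_add_im s
      simp only [hh, e, norm_mul]
      refine le_mul_of_one_le_right (norm_nonneg _) ?_
      rw [norm_exp, ← Real.exp_zero, Real.exp_le_exp, ← ofReal_pow, ofReal_re]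
      positivity
    refine (hval.trans h3).trans ?_
    simp only [ofReal_re]
    have hθ : θ₀ ≤ (s.re - l) / (5 - l) := by
      rw [le_div_iff₀ (by linarith), hθ₀]
      nlinarith
    have hθ1 : (s.re - l) / (5 - l) ≤ 1 := by
      rw [div_le_one (by linarith)]; linarith
    refine (rpow_mul_rpow_le_mul_add (by positivity) (by positivity) hη'0 (min_le_left _ _)
      (by positivity) hθ hθ1).trans ?_
    refine add_le_add_left ?_ _
    calc η' * (K * ℓ) ≤ η / K * (K * ℓ) := by gcongr; exact min_le_right _ _
      _ = η * ℓ := by field_simp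
  · refine ⟨K * ℓ, ?_⟩
    rintro _ ⟨z, hz, rfl⟩
    exact hbd z hz.1 hz.2
  · intro z hz
    have hz' : z.re = l := hz
    exact hbd z hz'.ge (hz'.le.trans hl5.le)
  · intro z hz
    have hz' : z.re = 5 := hz
    have h1 : ‖L (z + s.im * I)‖ ≤ C := hLC _ (by rw [hre, hz'])
    calc ‖h z‖ = ‖L (z + s.im * I)‖ * ‖exp (z ^ 2)‖ := norm_mul _ _
      _ ≤ C * (Real.exp 25 * 1) := by
        gcongr
        refine (hexp z (hl5.le.trans hz'.ge) hz'.le).trans ?_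
        gcongr
        rw [Real.exp_le_one_iff]
        nlinarith [sq_nonneg z.im]
      _ = _ := by ring

/-- Exponentiate: `|1 / zetaQuot| ≤ exp ‖L‖`, and `‖L‖ ≤ η log(2|t| + 21) + O(1)`. -/
lemma exists_norm_inv_zetaQuot_le (hRH : RiemannHypothesis) {δ : ℝ} (hδ : 0 < δ) (hδ1 : δ ≤ 1)
    {η : ℝ} (hη : 0 < η) :
    ∃ C : ℝ, 0 < C ∧ ∀ s : ℂ, 1 / 2 + δ ≤ s.re →
      ‖(zetaQuot s)⁻¹‖ ≤ C * (1 + |s.im|) ^ η := by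
  obtain ⟨L, hLd, hL, C₀, hC₀, hLC⟩ := exists_log_zetaQuot hRH
  obtain ⟨B, hB⟩ := exists_norm_log_zetaQuot_le hLd hL hC₀ hLC hδ hδ1 hη
  have hbound : ∀ s : ℂ, 1 / 2 + δ ≤ s.re →
      ‖L s‖ ≤ η * Real.log (2 * |s.im| + 21) + max B C₀ := by
    intro s hs
    rcases le_total s.re 5 with h | h
    · exact (hB s hs h).trans (by gcongr; exact le_max_left _ _)
    · have : 0 ≤ Real.log (2 * |s.im| + 21) :=
        Real.log_nonneg (by linarith [abs_nonneg s.im])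
      have h2 := (hLC s h).trans (le_max_right B C₀)
      have : 0 ≤ η * Real.log (2 * |s.im| + 21) := by positivity
      linarith
  refine ⟨21 ^ η * Real.exp (max B C₀), by positivity, fun s hs ↦ ?_⟩
  have hs' : 1 / 2 < s.re := by linarith
  have hpos : (0 : ℝ) < 2 * |s.im| + 21 := by positivity
  calc ‖(zetaQuot s)⁻¹‖ = ‖exp (-L s)‖ := by rw [← hL s hs', exp_neg]
    _ ≤ Real.exp ‖-L s‖ := norm_exp_le_exp_norm _
    _ ≤ Real.exp (η * Real.log (2 * |s.im| + 21) + max B C₀) := by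
      rw [norm_neg]; exact Real.exp_le_exp.mpr (hbound s hs)
    _ = (2 * |s.im| + 21) ^ η * Real.exp (max B C₀) := by
      rw [Real.exp_add, Real.rpow_def_of_pos hpos]; ring_nf
    _ ≤ (21 * (1 + |s.im|)) ^ η * Real.exp (max B C₀) := by
      gcongr; linarith [abs_nonneg s.im]
    _ = _ := by rw [Real.mul_rpow (by norm_num) (by positivity)]; ring

/-! ### The Dirichlet series of the Liouville function -/

/-- The summand `λ(n) n⁻ˢ` as a homomorphism of monoids with zero. -/
noncomputable def liouvilleSummandHom {s : ℂ} (hs : s ≠ 0) : ℕ →*₀ ℂ where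
  toFun n := ((ArithmeticFunction.liouville n : ℤ) : ℂ) * riemannZetaSummandHom hs n
  map_zero' := by simp
  map_one' := by simp [ArithmeticFunction.liouville_apply_one]
  map_mul' m n := by
    rw [ArithmeticFunction.liouville_apply_mul, map_mul]; push_cast; ring

lemma liouvilleSummandHom_apply {s : ℂ} (hs : s ≠ 0) (n : ℕ) :
    liouvilleSummandHom hs n = ((ArithmeticFunction.liouville n : ℤ) : ℂ) * (n : ℂ) ^ (-s) := rfl

lemma norm_liouville_le (n : ℕ) : ‖((ArithmeticFunction.liouville n : ℤ) : ℂ)‖ ≤ 1 := by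
  by_cases h : n = 0
  · simp [h]
  · simp [ArithmeticFunction.liouville_apply h]

lemma summable_norm_liouvilleSummandHom {s : ℂ} (hs : 1 < s.re) :
    Summable fun n ↦ ‖liouvilleSummandHom (ne_zero_of_one_lt_re hs) n‖ := by
  refine (summable_riemannZetaSummand hs).of_nonneg_of_le (fun _ ↦ norm_nonneg _) fun n ↦ ?_
  change ‖((ArithmeticFunction.liouville n : ℤ) : ℂ) * riemannZetaSummandHom _ n‖ ≤ _
  rw [norm_mul]
  exact mul_le_of_le_one_left (norm_nonneg _) (norm_liouville_le n)

/-- Compare Euler factors: `(1 + p⁻ˢ)⁻¹ (1 - p⁻ˢ)⁻¹ = (1 - p⁻²ˢ)⁻¹`. -/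
lemma tsum_liouville_mul_riemannZeta {s : ℂ} (hs : 1 < s.re) :
    (∑' n : ℕ, ((ArithmeticFunction.liouville n : ℤ) : ℂ) * (n : ℂ) ^ (-s)) * riemannZeta s =
      riemannZeta (2 * s) := by
  have hs2 : 1 < (2 * s).re := by simp; linarith
  have h1 := EulerProduct.eulerProduct_completely_multiplicative_hasProd
    (summable_norm_liouvilleSummandHom hs)
  have h2 := riemannZeta_eulerProduct_hasProd hs
  have h3 := riemannZeta_eulerProduct_hasProd hs2
  refine (h1.mul h2).unique (h3.congr_fun ?_)
  intro p
  have hp : ArithmeticFunction.liouville (p : ℕ) = -1 := by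
    rw [ArithmeticFunction.liouville_apply p.2.ne_zero,
      ArithmeticFunction.cardFactors_apply_prime p.2, pow_one]
  have hp2 : ((p : ℕ) : ℂ) ^ (-(2 * s)) = (((p : ℕ) : ℂ) ^ (-s)) ^ 2 := by
    rw [← cpow_nat_mul]; push_cast; ring_nf
  rw [liouvilleSummandHom_apply, hp, hp2, ← mul_inv]
  push_cast
  ring_nf

/-- The analytic continuation `ζ(2s) / ζ(s)` of the Dirichlet series of the Liouville function. -/
noncomputable def liouvilleZeta (s : ℂ) : ℂ :=
  riemannZeta (2 * s) * ((s - 1) / s) * (zetaQuot s)⁻¹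

lemma tsum_liouville_eq {s : ℂ} (hs : 1 < s.re) :
    ∑' n : ℕ, ((ArithmeticFunction.liouville n : ℤ) : ℂ) * (n : ℂ) ^ (-s) = liouvilleZeta s := by
  have hs1 : s ≠ 1 := by rintro rfl; simp at hs
  have hs0 : s ≠ 0 := by rintro rfl; norm_num at hs
  have hz : riemannZeta s ≠ 0 := riemannZeta_ne_zero_of_one_le_re hs.le
  have h1 : s - 1 ≠ 0 := sub_ne_zero.mpr hs1
  rw [liouvilleZeta, ← tsum_liouville_mul_riemannZeta hs, zetaQuot_eq hs1]
  field_simp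

lemma differentiableAt_liouvilleZeta (hRH : RiemannHypothesis) {s : ℂ} (hs : 1 / 2 < s.re) :
    DifferentiableAt ℂ liouvilleZeta s := by
  have hs0 : s ≠ 0 := by rintro rfl; norm_num at hs
  have h2 : 2 * s ≠ 1 := by
    intro h
    have := congrArg re h
    simp at this
    linarith
  have hz : DifferentiableAt ℂ (fun s ↦ riemannZeta (2 * s)) s :=
    (differentiableAt_riemannZeta h2).comp s (by fun_prop)
  have hq : DifferentiableAt ℂ (fun s ↦ (zetaQuot s)⁻¹) s :=
    (differentiableAt_zetaQuot hs0).fun_inv (zetaQuot_ne_zero hRH hs)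
  have hr : DifferentiableAt ℂ (fun s : ℂ ↦ (s - 1) / s) s := by fun_prop (disch := assumption)
  exact (hz.fun_mul hr).fun_mul hq

/-- Only `1 / zetaQuot` can grow: `ζ(2s)` is bounded because `Re 2s ≥ 1 + 2δ`, and `(s - 1)/s`
because `‖s‖ ≥ 1/2`. -/
lemma exists_norm_liouvilleZeta_le (hRH : RiemannHypothesis) {δ : ℝ} (hδ : 0 < δ) (hδ1 : δ ≤ 1)
    {η : ℝ} (hη : 0 < η) :
    ∃ C : ℝ, 0 < C ∧ ∀ s : ℂ, 1 / 2 + δ ≤ s.re →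
      ‖liouvilleZeta s‖ ≤ C * (1 + |s.im|) ^ η := by
  obtain ⟨C, hC, h⟩ := exists_norm_inv_zetaQuot_le hRH hδ hδ1 hη
  set Z : ℝ := ‖riemannZeta ((1 + 2 * δ : ℝ) : ℂ)‖ with hZ
  refine ⟨(Z + 1) * 3 * C, by positivity, fun s hs ↦ ?_⟩
  have h1 : ‖riemannZeta (2 * s)‖ ≤ Z + 1 := by
    refine (norm_riemannZeta_le (σ := 1 + 2 * δ) (by linarith) ?_).trans (by linarith)
    simp; linarith
  have hn : 1 / 2 ≤ ‖s‖ := by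
    have := re_le_norm s
    linarith
  have h2 : ‖(s - 1) / s‖ ≤ 3 := by
    rw [norm_div, div_le_iff₀ (by linarith)]
    have := norm_sub_le s 1
    rw [norm_one] at this
    linarith
  calc ‖liouvilleZeta s‖ = ‖riemannZeta (2 * s)‖ * ‖(s - 1) / s‖ * ‖(zetaQuot s)⁻¹‖ := by
        rw [liouvilleZeta, norm_mul, norm_mul]
    _ ≤ (Z + 1) * 3 * (C * (1 + |s.im|) ^ η) := by
      gcongr
      exact h s hs
    _ = _ := by ring

/-! ### Contour shift and Perron's formula with an integrable kernel -/

lemma re_ofReal_add_ofReal_mul_I (a y : ℝ) : ((a : ℂ) + y * I).re = a := by simp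

lemma im_ofReal_add_ofReal_mul_I (a y : ℝ) : ((a : ℂ) + y * I).im = y := by simp

lemma integrable_one_add_abs_rpow_neg {r : ℝ} (hr : 1 < r) :
    Integrable fun y : ℝ ↦ (1 + |y|) ^ (-r) := by
  have := integrable_one_add_norm (E := ℝ) (μ := volume) (r := r) (by simpa using hr)
  simpa using this

/-- A vertical line integral of a holomorphic function with power decay may be shifted. -/
lemma integral_vertical_line_eq {f : ℂ → ℂ} {a b B r : ℝ} (hab : a ≤ b) (hr : 1 < r)
    (hf : ∀ z : ℂ, a ≤ z.re → z.re ≤ b → DifferentiableAt ℂ f z)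
    (hB : ∀ z : ℂ, a ≤ z.re → z.re ≤ b → ‖f z‖ ≤ B * (1 + |z.im|) ^ (-r)) :
    ∫ y : ℝ, f (a + y * I) = ∫ y : ℝ, f (b + y * I) := by
  have hint : ∀ c : ℝ, a ≤ c → c ≤ b → Integrable fun y : ℝ ↦ f (c + y * I) := by
    intro c h1 h2
    refine ((integrable_one_add_abs_rpow_neg hr).const_mul B).mono' ?_ ?_
    · refine Continuous.aestronglyMeasurable (continuous_iff_continuousAt.mpr fun y ↦ ?_)
      have := (hf (c + y * I) (by simpa using h1) (by simpa using h2)).continuousAt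
      exact ContinuousAt.comp (f := fun y : ℝ ↦ (c : ℂ) + y * I) this (by fun_prop)
    · refine Eventually.of_forall fun y ↦ ?_
      simpa using hB (c + y * I) (by simpa using h1) (by simpa using h2)
  have hlim : ∀ c : ℝ, a ≤ c → c ≤ b → Tendsto (fun T : ℝ ↦ ∫ y in (-T)..T, f (c + y * I)) atTop
      (𝓝 (∫ y : ℝ, f (c + y * I))) := fun c h1 h2 ↦
    intervalIntegral_tendsto_integral (hint c h1 h2) tendsto_neg_atTop_atBot tendsto_id
  -- Taking `g T = T` and `g T = -T` treats both horizontal edges at once.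
  have hhor : ∀ g : ℝ → ℝ, (∀ T, |g T| = |T|) →
      Tendsto (fun T : ℝ ↦ ∫ x in a..b, f (x + g T * I)) atTop (𝓝 0) := by
    intro g hg
    have hz : Tendsto (fun T : ℝ ↦ B * (1 + |T|) ^ (-r) * |b - a|) atTop (𝓝 0) := by
      have h1 : Tendsto (fun T : ℝ ↦ 1 + |T|) atTop atTop :=
        tendsto_atTop_add_const_left _ _ tendsto_abs_atTop_atTop
      have := ((tendsto_rpow_neg_atTop (by linarith : 0 < r)).comp h1).const_mul B
      simpa using this.mul_const |b - a|
    refine squeeze_zero_norm (fun T ↦ ?_) hz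
    refine intervalIntegral.norm_integral_le_of_norm_le_const fun x hx ↦ ?_
    rw [uIoc_of_le hab] at hx
    have := hB (x + g T * I) (by simpa using hx.1.le) (by simpa using hx.2)
    rwa [im_ofReal_add_ofReal_mul_I, hg] at this
  have hrect : ∀ T : ℝ, I * (∫ y in (-T)..T, f (b + y * I)) - I * (∫ y in (-T)..T, f (a + y * I)) =
      (∫ x in a..b, f (x + (T : ℝ) * I)) - ∫ x in a..b, f (x + ((-T : ℝ) : ℂ) * I) := by
    intro T
    have := integral_boundary_rect_eq_zero_of_differentiableOn f (a + (-T : ℝ) * I)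
      (b + (T : ℝ) * I) ?_
    · simp only [re_ofReal_add_ofReal_mul_I, im_ofReal_add_ofReal_mul_I, smul_eq_mul] at this
      linear_combination this
    · intro z hz
      rw [re_ofReal_add_ofReal_mul_I, re_ofReal_add_ofReal_mul_I, uIcc_of_le hab] at hz
      exact (hf z hz.1.1 hz.1.2).differentiableWithinAt
  have h1 := ((hlim b hab le_rfl).const_mul I).sub ((hlim a le_rfl hab).const_mul I)
  have h2 := (hhor (fun T ↦ T) fun T ↦ rfl).sub (hhor (fun T ↦ -T) fun T ↦ abs_neg T)
  simp_rw [hrect] at h1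
  have h3 := tendsto_nhds_unique h1 h2
  rw [sub_zero, ← mul_sub, mul_eq_zero, sub_eq_zero] at h3
  exact (h3.resolve_left I_ne_zero).symm

/-- The function `max (1 - t) 0` on `(0, ∞)`. -/
noncomputable def rieszWeight (t : ℝ) : ℂ :=
  (Ioc 0 1).indicator (fun _ ↦ (1 : ℂ)) t - (Ioc 0 1).indicator (fun t : ℝ ↦ (t : ℂ) ^ (1 : ℂ)) t

lemma rieszWeight_eq {t : ℝ} (ht : 0 < t) : rieszWeight t = ((max (1 - t) 0 : ℝ) : ℂ) := by
  unfold rieszWeight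
  by_cases h : t ≤ 1
  · have hm : t ∈ Ioc (0 : ℝ) 1 := ⟨ht, h⟩
    rw [indicator_of_mem hm, indicator_of_mem hm, max_eq_left (by linarith), cpow_one]
    push_cast; rfl
  · rw [indicator_of_notMem (fun h' ↦ h h'.2), indicator_of_notMem (fun h' ↦ h h'.2),
      max_eq_right (by linarith)]
    simp

lemma hasMellin_rieszWeight {z : ℂ} (hz : 0 < z.re) :
    HasMellin rieszWeight z (1 / (z * (z + 1))) := by
  have h := hasMellin_sub (hasMellin_one_Ioc hz).1
    (hasMellin_cpow_Ioc 1 (s := z) (by simp; linarith)).1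
  rw [(hasMellin_one_Ioc hz).2, (hasMellin_cpow_Ioc 1 (s := z) (by simp; linarith)).2] at h
  have hz0 : z ≠ 0 := by rintro rfl; simp at hz
  have hz1 : z + 1 ≠ 0 := by
    intro h
    have := congrArg re h
    simp at this
    linarith
  have e : 1 / (z * (z + 1)) = 1 / z - 1 / (z + 1) := by field_simp; ring
  rw [e]
  exact h

lemma one_add_abs_le_norm {c : ℝ} (hc : 0 < c) (hc1 : c ≤ 1) {z : ℂ} (hz : c ≤ z.re) :
    c / 2 * (1 + |z.im|) ≤ ‖z‖ := by
  have h1 := re_le_norm z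
  have h2 := abs_im_le_norm z
  nlinarith [abs_nonneg z.im]

lemma norm_inv_mul_add_one_le {c : ℝ} (hc : 0 < c) (hc1 : c ≤ 1) {z : ℂ} (hz : c ≤ z.re) :
    ‖1 / (z * (z + 1))‖ ≤ 4 / c * (1 + |z.im|) ^ (-2 : ℝ) := by
  have h1 := one_add_abs_le_norm hc hc1 hz
  have h2 := one_add_abs_le_norm one_pos le_rfl (z := z + 1) (by simp; linarith)
  simp only [add_im, one_im, add_zero] at h2
  rw [norm_div, norm_one, norm_mul, Real.rpow_neg (by positivity), Real.rpow_two]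
  calc 1 / (‖z‖ * ‖z + 1‖) ≤ 1 / (c / 2 * (1 + |z.im|) * (1 / 2 * (1 + |z.im|))) := by gcongr
    _ = _ := by field_simp; norm_num

lemma integrable_cpow_mul_inv {c : ℝ} (hc : 0 < c) (hc1 : c ≤ 1) :
    Integrable fun y : ℝ ↦ 1 / (((c : ℂ) + y * I) * (((c : ℂ) + y * I) + 1)) := by
  refine ((integrable_one_add_abs_rpow_neg (r := 2) (by norm_num)).const_mul (4 / c)).mono' ?_ ?_
  · refine Continuous.aestronglyMeasurable (Continuous.div (by fun_prop) (by fun_prop) fun y h ↦ ?_)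
    rcases mul_eq_zero.mp h with h | h
    · have := congrArg re h
      simp at this
      linarith
    · have := congrArg re h
      simp at this
      linarith
  · refine Eventually.of_forall fun y ↦ ?_
    have := norm_inv_mul_add_one_le hc hc1 (z := c + y * I) (by simp)
    rwa [im_ofReal_add_ofReal_mul_I] at this

/-- Perron's formula with the Riesz weight of order one. -/
lemma integral_cpow_div_mul_add_one {c : ℝ} (hc : 0 < c) (hc1 : c ≤ 1) {x : ℝ} (hx : 0 < x) :
    ∫ y : ℝ, (x : ℂ) ^ (-((c : ℂ) + y * I)) * (1 / (((c : ℂ) + y * I) * ((c : ℂ) + y * I + 1))) =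
      2 * Real.pi * ((max (1 - x) 0 : ℝ) : ℂ) := by
  have hm : ∀ y : ℝ, mellin rieszWeight (c + y * I) =
      1 / (((c : ℂ) + y * I) * ((c : ℂ) + y * I + 1)) := fun y ↦
    (hasMellin_rieszWeight (by simpa using hc)).2
  have hcont : ContinuousAt rieszWeight x := by
    have : rieszWeight =ᶠ[𝓝 x] fun t ↦ ((max (1 - t) 0 : ℝ) : ℂ) := by
      filter_upwards [Ioi_mem_nhds hx] with t ht using rieszWeight_eq ht
    exact ContinuousAt.congr (by fun_prop) this.symm
  -- The formula is Mellin inversion for `rieszWeight`.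
  have h := mellinInv_mellin_eq c rieszWeight hx (hasMellin_rieszWeight (by simpa using hc)).1
    ((integrable_cpow_mul_inv hc hc1).congr (Eventually.of_forall fun y ↦ (hm y).symm)) hcont
  rw [mellinInv] at h
  simp_rw [hm, smul_eq_mul] at h
  rw [rieszWeight_eq hx] at h
  rw [← h, real_smul, ← mul_assoc]
  push_cast
  rw [mul_one_div_cancel (by simp), one_mul]

/-- The Perron kernel whose integral against `n⁻ᶻ` is `2π` for `n ≤ N` and `0` for `n > N`. -/
noncomputable def perronKernel (N : ℕ) (z : ℂ) : ℂ :=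
  (((N : ℂ) + 1) ^ (z + 1) - (N : ℂ) ^ (z + 1)) / (z * (z + 1))

lemma cpow_neg_mul_cpow_add_one {n m : ℕ} (hn : n ≠ 0) (hm : m ≠ 0) (z : ℂ) :
    (n : ℂ) ^ (-z) * (m : ℂ) ^ (z + 1) = m * ((n / m : ℝ) : ℂ) ^ (-z) := by
  have hm' : (m : ℂ) ≠ 0 := by exact_mod_cast hm
  have hd : ((n / m : ℝ) : ℂ) = ((n : ℝ) : ℂ) * (((m : ℝ)⁻¹ : ℝ) : ℂ) := by
    push_cast; rw [div_eq_mul_inv]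
  have hi : ((((m : ℝ)⁻¹ : ℝ)) : ℂ) ^ (-z) = (m : ℂ) ^ z := by
    rw [ofReal_inv, ofReal_natCast, inv_cpow _ _ (by simp [Real.pi_ne_zero.symm]),
      cpow_neg, inv_inv]
  rw [cpow_add _ _ hm', cpow_one, hd, mul_cpow_ofReal_nonneg (by positivity) (by positivity), hi]
  push_cast
  ring

lemma integrable_ofReal_cpow_neg_mul {c : ℝ} (hc : 0 < c) (hc1 : c ≤ 1) {x : ℝ} (hx : 0 < x) :
    Integrable fun y : ℝ ↦
      (x : ℂ) ^ (-((c : ℂ) + y * I)) * (1 / (((c : ℂ) + y * I) * ((c : ℂ) + y * I + 1))) := by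
  refine (integrable_cpow_mul_inv hc hc1).bdd_mul (c := x ^ (-c)) ?_ ?_
  · refine Continuous.aestronglyMeasurable ?_
    have hx0 : (x : ℂ) ≠ 0 := by exact_mod_cast hx.ne'
    exact Continuous.const_cpow (by fun_prop) (Or.inl hx0)
  · refine Eventually.of_forall fun y ↦ ?_
    rw [norm_cpow_eq_rpow_re_of_pos hx]
    simp

lemma cpow_neg_mul_perronKernel {n N : ℕ} (hn : n ≠ 0) (hN : N ≠ 0) (z : ℂ) :
    (n : ℂ) ^ (-z) * perronKernel N z =
      ((N + 1 : ℕ) : ℂ) * (((n / (N + 1 : ℕ) : ℝ) : ℂ) ^ (-z) * (1 / (z * (z + 1)))) -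
      (N : ℂ) * (((n / N : ℝ) : ℂ) ^ (-z) * (1 / (z * (z + 1)))) := by
  have h1 := cpow_neg_mul_cpow_add_one hn (Nat.succ_ne_zero N) z
  have h2 := cpow_neg_mul_cpow_add_one hn hN z
  rw [← mul_assoc, ← mul_assoc, ← h2, ← h1, perronKernel]
  push_cast
  ring

lemma integrable_cpow_neg_mul_perronKernel {c : ℝ} (hc : 0 < c) (hc1 : c ≤ 1) {n N : ℕ}
    (hn : n ≠ 0) (hN : N ≠ 0) :
    Integrable fun y : ℝ ↦ (n : ℂ) ^ (-((c : ℂ) + y * I)) * perronKernel N (c + y * I) := by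
  simp_rw [cpow_neg_mul_perronKernel hn hN]
  have hn' : (0 : ℝ) < n := by positivity
  exact ((integrable_ofReal_cpow_neg_mul hc hc1 (by positivity)).const_mul _).sub
    ((integrable_ofReal_cpow_neg_mul hc hc1 (by positivity)).const_mul _)

/-- The two Riesz weights give `(N + 1 - n)₊ - (N - n)₊`, which is `1` for `n ≤ N` and `0` for `n ≥
N + 1`; an integer `n` never meets the ramp between. -/
lemma integral_cpow_neg_mul_perronKernel {c : ℝ} (hc : 0 < c) (hc1 : c ≤ 1) {n N : ℕ}
    (hn : n ≠ 0) (hN : N ≠ 0) :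
    ∫ y : ℝ, (n : ℂ) ^ (-((c : ℂ) + y * I)) * perronKernel N (c + y * I) =
      2 * Real.pi * if n ≤ N then 1 else 0 := by
  simp_rw [cpow_neg_mul_perronKernel hn hN]
  have hn' : (0 : ℝ) < n := by positivity
  have hN' : (0 : ℝ) < N := by positivity
  rw [integral_sub, integral_const_mul, integral_const_mul,
    integral_cpow_div_mul_add_one hc hc1 (by positivity),
    integral_cpow_div_mul_add_one hc hc1 (by positivity)]
  · have h1 : ∀ m : ℕ, m ≠ 0 → (m : ℂ) * (2 * Real.pi * ((max (1 - (n / m : ℝ)) 0 : ℝ) : ℂ)) =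
        2 * Real.pi * ((max ((m : ℝ) - n) 0 : ℝ) : ℂ) := by
      intro m hm
      have hm' : (0 : ℝ) < m := by positivity
      have : max ((m : ℝ) - n) 0 = m * max (1 - (n / m : ℝ)) 0 := by
        rw [mul_max_of_nonneg _ _ hm'.le]
        congr 1
        · field_simp
        · simp
      rw [this]
      push_cast
      ring
    rw [h1 _ (Nat.succ_ne_zero N), h1 _ hN, ← mul_sub, ← ofReal_sub]
    congr 1
    split_ifs with h
    · have : (n : ℝ) ≤ N := by exact_mod_cast h
      rw [max_eq_left (by push_cast; linarith), max_eq_left (by linarith)]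
      push_cast; ring
    · have : (N : ℝ) + 1 ≤ n := by exact_mod_cast not_le.mp h
      rw [max_eq_right (by push_cast; linarith), max_eq_right (by linarith)]
      simp
  · exact (integrable_ofReal_cpow_neg_mul hc hc1 (by positivity)).const_mul _
  · exact (integrable_ofReal_cpow_neg_mul hc hc1 (by positivity)).const_mul _

/-- Perron's formula for the partial sums of an absolutely convergent Dirichlet series. -/
lemma two_pi_mul_sum_eq_integral {c : ℝ} (hc : 0 < c) (hc1 : c ≤ 1) {a : ℕ → ℂ} (ha0 : a 0 = 0)
    (ha : Summable fun n : ℕ ↦ ‖a n‖ * (n : ℝ) ^ (-c)) {N : ℕ} (hN : N ≠ 0) :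
    2 * Real.pi * ∑ n ∈ Finset.Icc 1 N, a n =
      ∫ y : ℝ, (∑' n : ℕ, a n * (n : ℂ) ^ (-((c : ℂ) + y * I))) * perronKernel N (c + y * I) := by
  set F : ℕ → ℝ → ℂ := fun n y ↦
    a n * ((n : ℂ) ^ (-((c : ℂ) + y * I)) * perronKernel N (c + y * I)) with hF
  have hFi : ∀ n, Integrable (F n) := by
    intro n
    by_cases hn : n = 0
    · subst hn
      simp [hF, ha0]
    · exact (integrable_cpow_neg_mul_perronKernel hc hc1 hn hN).const_mul _
  have hnorm : ∀ n, ∫ y, ‖F n y‖ =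
      ‖a n‖ * (n : ℝ) ^ (-c) * ∫ y : ℝ, ‖perronKernel N (c + y * I)‖ := by
    intro n
    by_cases hn : n = 0
    · subst hn
      simp [hF, ha0]
    · rw [← integral_const_mul]
      congr with y
      rw [hF]
      simp only [norm_mul]
      rw [norm_natCast_cpow_of_pos (Nat.pos_of_ne_zero hn)]
      simp [mul_assoc]
  have hsum : Summable fun n ↦ ∫ y, ‖F n y‖ := by
    simp_rw [hnorm]
    exact ha.mul_right _
  have key := hasSum_integral_of_summable_integral_norm hFi hsum
  have hval : ∀ n, ∫ y, F n y = if n ∈ Finset.Icc 1 N then 2 * Real.pi * a n else 0 := by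
    intro n
    by_cases hn : n = 0
    -- `a 0 = 0` removes the term `n = 0`, to which the Perron integral does not apply.
    · subst hn
      simp [hF, ha0]
    · rw [hF]
      simp only
      rw [integral_const_mul, integral_cpow_neg_mul_perronKernel hc hc1 hn hN]
      simp only [Finset.mem_Icc, Nat.one_le_iff_ne_zero, ne_eq, hn, not_false_eq_true, true_and]
      split_ifs <;> ring
  simp_rw [hval] at key
  have key2 := hasSum_sum_of_ne_finset_zero (L := .unconditional ℕ) (s := Finset.Icc 1 N)
    (f := fun n ↦ if n ∈ Finset.Icc 1 N then 2 * Real.pi * a n else 0) fun n hn ↦ if_neg hn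
  have := key2.unique key
  rw [Finset.sum_congr rfl (g := fun n ↦ 2 * Real.pi * a n) fun n hn ↦ if_pos hn,
    ← Finset.mul_sum] at this
  rw [this]
  congr with y
  rw [hF, ← tsum_mul_right]
  congr with n
  ring

/-! ### Size of the Perron kernel -/

lemma norm_cpow_sub_cpow_le {N : ℕ} (hN : N ≠ 0) {z : ℂ} (hz : 0 < z.re) :
    ‖((N : ℂ) + 1) ^ (z + 1) - (N : ℂ) ^ (z + 1)‖ ≤ ‖z + 1‖ * ((N : ℝ) + 1) ^ z.re := by
  have hN' : (0 : ℝ) < N := by positivity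
  have hz1 : z + 1 ≠ 0 := by
    intro h
    have := congrArg re h
    simp at this
    linarith
  have hder : ∀ x ∈ Icc (N : ℝ) (N + 1),
      HasDerivWithinAt (fun x : ℝ ↦ (x : ℂ) ^ (z + 1)) ((z + 1) * (x : ℂ) ^ z)
        (Icc (N : ℝ) (N + 1)) x := by
    intro x hx
    have hx0 : x ≠ 0 := (hN'.trans_le hx.1).ne'
    have := (hasDerivAt_ofReal_cpow_const' hx0 (r := z) (by grind)).const_mul (z + 1)
    refine (this.congr_of_eventuallyEq ?_).hasDerivWithinAt
    filter_upwards with w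
    field_simp
  have := Convex.norm_image_sub_le_of_norm_hasDerivWithin_le hder
    (C := ‖z + 1‖ * ((N : ℝ) + 1) ^ z.re) ?_ (convex_Icc _ _)
    (left_mem_Icc.mpr (by linarith)) (right_mem_Icc.mpr (by linarith))
  · simpa using this
  · intro x hx
    have hx0 : 0 < x := hN'.trans_le hx.1
    rw [norm_mul, norm_cpow_eq_rpow_re_of_pos hx0]
    gcongr
    exact hx.2

lemma norm_cpow_sub_cpow_le' (N : ℕ) {z : ℂ} (hz : 0 < z.re) :
    ‖((N : ℂ) + 1) ^ (z + 1) - (N : ℂ) ^ (z + 1)‖ ≤ 2 * ((N : ℝ) + 1) ^ (z.re + 1) := by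
  have h : ∀ m : ℕ, ‖(m : ℂ) ^ (z + 1)‖ = (m : ℝ) ^ (z.re + 1) := by
    intro m
    rw [norm_natCast_cpow_of_re_ne_zero]
    · simp
    · simp; linarith
  have h1 := h (N + 1)
  push_cast at h1
  refine (norm_sub_le _ _).trans ?_
  rw [h1, h]
  have : (N : ℝ) ^ (z.re + 1) ≤ ((N : ℝ) + 1) ^ (z.re + 1) := by gcongr; linarith
  linarith

/-- The numerator has a mean value bound, sharp in `N` but growing with `z`, and a trivial bound,
uniform in `Im z` but a factor `N` worse. Their geometric mean with weights `1 - η` and `η` costs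
`N^η` and makes the kernel integrable. -/
lemma norm_perronKernel_le {N : ℕ} (hN : N ≠ 0) {z : ℂ} {c η : ℝ} (hc : 0 < c) (hc1 : c ≤ 1)
    (hz : c ≤ z.re) (hη : 0 ≤ η) (hη1 : η ≤ 1) :
    ‖perronKernel N z‖ ≤ 8 / c * ((N : ℝ) + 1) ^ (z.re + η) * (1 + |z.im|) ^ (-(1 + η)) := by
  have hz0 : 0 < z.re := hc.trans_le hz
  set d : ℝ := ‖((N : ℂ) + 1) ^ (z + 1) - (N : ℂ) ^ (z + 1)‖ with hd
  set M : ℝ := (N : ℝ) + 1 with hM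
  have hM0 : 0 < M := by positivity
  set w : ℝ := 1 + |z.im| with hw
  have hw0 : 0 < w := by positivity
  have h1 := one_add_abs_le_norm hc hc1 hz
  have h2 : 1 / 2 * w ≤ ‖z + 1‖ := by
    have := one_add_abs_le_norm one_pos le_rfl (z := z + 1) (by simp; linarith)
    simpa using this
  have hz1 : 0 < ‖z + 1‖ := lt_of_lt_of_le (by positivity) h2
  have hd0 : 0 ≤ d := norm_nonneg _
  have hdle : d ≤ ‖z + 1‖ * (2 * M ^ (z.re + η) * ‖z + 1‖ ^ (-η)) := by
    calc d = d ^ (1 - η) * d ^ η := by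
          rw [← Real.rpow_add_of_nonneg hd0 (by linarith) hη]; simp
      _ ≤ (‖z + 1‖ * M ^ z.re) ^ (1 - η) * (2 * M ^ (z.re + 1)) ^ η := by
        have := norm_cpow_sub_cpow_le hN hz0
        have := norm_cpow_sub_cpow_le' N hz0
        gcongr
      _ = 2 ^ η * (‖z + 1‖ ^ (1 - η) * M ^ (z.re + η)) := by
        rw [Real.mul_rpow (by positivity) (by positivity),
          Real.mul_rpow (by positivity) (by positivity), ← Real.rpow_mul hM0.le,
          ← Real.rpow_mul hM0.le,
          show z.re + η = z.re * (1 - η) + (z.re + 1) * η by ring, Real.rpow_add hM0]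
        ring
      _ ≤ 2 * (‖z + 1‖ ^ (1 - η) * M ^ (z.re + η)) := by
        gcongr
        exact (Real.rpow_le_rpow_of_exponent_le one_le_two hη1).trans_eq (Real.rpow_one 2)
      _ = _ := by
        rw [sub_eq_add_neg, Real.rpow_add hz1, Real.rpow_one]; ring
  have hpow : ‖z + 1‖ ^ (-η) ≤ 2 * w ^ (-η) := by
    calc ‖z + 1‖ ^ (-η) ≤ (1 / 2 * w) ^ (-η) :=
          Real.rpow_le_rpow_of_nonpos (by positivity) h2 (by linarith)
      _ = 2 ^ η * w ^ (-η) := by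
        rw [Real.mul_rpow (by norm_num) hw0.le, one_div, Real.inv_rpow (by norm_num),
          Real.rpow_neg (by norm_num), inv_inv]
      _ ≤ 2 * w ^ (-η) := by
        gcongr
        exact (Real.rpow_le_rpow_of_exponent_le one_le_two hη1).trans_eq (Real.rpow_one 2)
  calc ‖perronKernel N z‖ = d / (‖z‖ * ‖z + 1‖) := by rw [perronKernel, norm_div, norm_mul]
    _ ≤ ‖z + 1‖ * (2 * M ^ (z.re + η) * (2 * w ^ (-η))) / (c / 2 * w * ‖z + 1‖) := by
      gcongr
      exact hdle.trans (by gcongr)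
    _ = 8 / c * M ^ (z.re + η) * (w ^ (-η) * w⁻¹) := by field_simp; ring
    _ = _ := by
      rw [neg_add, add_comm (-1 : ℝ), Real.rpow_add hw0, Real.rpow_neg_one]

/-! ### Partial sums on the critical line -/

/-- Under the Riemann hypothesis, partial sums of `λ(n) n^(-1/2-it)` up to `N` are
`O((1 + |t|)^ε (N + 1)^ε)`. -/
lemma exists_norm_sum_liouville_le (hRH : RiemannHypothesis) {ε : ℝ} (hε : 0 < ε) (hε1 : ε ≤ 1) :
    ∃ C : ℝ, 0 < C ∧ ∀ (N : ℕ) (t : ℝ),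
      ‖∑ n ∈ Finset.Icc 1 N, ((ArithmeticFunction.liouville n : ℤ) : ℂ) *
        (n : ℂ) ^ (-((1 / 2 : ℂ) + I * (t : ℂ)))‖ ≤ C * (1 + |t|) ^ ε * ((N : ℝ) + 1) ^ ε := by
  -- The line `Re z = δ` and the kernel's loss each cost `N^δ`, in all `N^ε`. With growth `δ/2` for
  -- `liouvilleZeta` against kernel decay `1 + δ`, the integrand still decays with exponent `1 +
  -- δ/2`.
  set δ : ℝ := ε / 2 with hδ
  have hδ0 : 0 < δ := by positivity
  have hδ1 : δ ≤ 1 := by linarith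
  obtain ⟨C, hC, hF⟩ := exists_norm_liouvilleZeta_le hRH hδ0 hδ1 (half_pos hδ0)
  set J : ℝ := ∫ y : ℝ, (1 + |y|) ^ (-(1 + δ / 2)) with hJ
  have hJi : Integrable fun y : ℝ ↦ (1 + |y|) ^ (-(1 + δ / 2)) :=
    integrable_one_add_abs_rpow_neg (by linarith)
  have hJ0 : 0 ≤ J := integral_nonneg fun y ↦ by positivity
  refine ⟨C * (8 / δ) * (J + 1), by positivity, fun N t ↦ ?_⟩
  rcases eq_or_ne N 0 with rfl | hN
  · simp only [zero_lt_one, Finset.Icc_eq_empty_of_lt, Finset.sum_empty, norm_zero]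
    positivity
  set s₀ : ℂ := (1 / 2 : ℂ) + I * (t : ℂ) with hs₀
  have hs₀re : s₀.re = 1 / 2 := by simp [hs₀]
  have hs₀im : s₀.im = t := by simp [hs₀]
  have hN1 : (1 : ℝ) ≤ (N : ℝ) + 1 := by linarith [(Nat.cast_nonneg N : (0 : ℝ) ≤ N)]
  have hbound : ∀ z : ℂ, δ ≤ z.re →
      ‖liouvilleZeta (s₀ + z) * perronKernel N z‖ ≤
        C * (8 / δ) * (1 + |t|) ^ ε * ((N : ℝ) + 1) ^ (z.re + δ) *
          (1 + |z.im|) ^ (-(1 + δ / 2)) := by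
    intro z hz
    have h1 : ‖liouvilleZeta (s₀ + z)‖ ≤ C * ((1 + |t|) ^ ε * (1 + |z.im|) ^ (δ / 2)) := by
      refine (hF _ (by rw [add_re, hs₀re]; linarith)).trans ?_
      gcongr
      rw [add_im, hs₀im]
      calc (1 + |t + z.im|) ^ (δ / 2) ≤ ((1 + |t|) * (1 + |z.im|)) ^ (δ / 2) := by
            gcongr
            have := abs_add_le t z.im
            nlinarith [mul_nonneg (abs_nonneg t) (abs_nonneg z.im)]
        _ = (1 + |t|) ^ (δ / 2) * (1 + |z.im|) ^ (δ / 2) :=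
            Real.mul_rpow (by positivity) (by positivity)
        _ ≤ (1 + |t|) ^ ε * (1 + |z.im|) ^ (δ / 2) := by
            gcongr
            · linarith [abs_nonneg t]
            · linarith
    have h2 := norm_perronKernel_le hN hδ0 hδ1 hz hδ0.le hδ1
    calc _ = ‖liouvilleZeta (s₀ + z)‖ * ‖perronKernel N z‖ := norm_mul _ _
      _ ≤ C * ((1 + |t|) ^ ε * (1 + |z.im|) ^ (δ / 2)) *
          (8 / δ * ((N : ℝ) + 1) ^ (z.re + δ) * (1 + |z.im|) ^ (-(1 + δ))) := by gcongr
      _ = C * (8 / δ) * (1 + |t|) ^ ε * ((N : ℝ) + 1) ^ (z.re + δ) *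
          ((1 + |z.im|) ^ (δ / 2) * (1 + |z.im|) ^ (-(1 + δ))) := by ring
      _ = _ := by
        rw [← Real.rpow_add (by positivity)]
        congr 2
        ring
  have hdiff : ∀ z : ℂ, δ ≤ z.re →
      DifferentiableAt ℂ (fun z ↦ liouvilleZeta (s₀ + z) * perronKernel N z) z := by
    intro z hz
    have hz0 : z ≠ 0 := by rintro rfl; simp at hz; linarith
    have hz1 : z + 1 ≠ 0 := by
      intro h
      have := congrArg re h
      simp at this
      linarith
    have hL : DifferentiableAt ℂ (fun z ↦ liouvilleZeta (s₀ + z)) z :=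
      DifferentiableAt.comp z (differentiableAt_liouvilleZeta hRH
        (by rw [add_re, hs₀re]; linarith)) (by fun_prop)
    have hNc : (N : ℂ) ≠ 0 := by exact_mod_cast hN
    have hNc1 : (N : ℂ) + 1 ≠ 0 := by exact_mod_cast Nat.succ_ne_zero N
    have hK : DifferentiableAt ℂ (perronKernel N) z := by
      unfold perronKernel
      refine DifferentiableAt.fun_div (DifferentiableAt.fun_sub ?_ ?_) (by fun_prop)
        (mul_ne_zero hz0 hz1)
      · exact DifferentiableAt.const_cpow (by fun_prop) (Or.inl hNc1)
      · exact DifferentiableAt.const_cpow (by fun_prop) (Or.inl hNc)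
    exact hL.fun_mul hK
  -- No residue arises: the kernel's pole `z = 0` and any singularity of `liouvilleZeta (s₀ + z)`
  -- lie left of `Re z = δ`.
  have hshift := integral_vertical_line_eq (f := fun z ↦ liouvilleZeta (s₀ + z) * perronKernel N z)
    (a := δ) (b := 1) (B := C * (8 / δ) * (1 + |t|) ^ ε * ((N : ℝ) + 1) ^ (1 + δ))
    (r := 1 + δ / 2) hδ1 (by linarith) (fun z h _ ↦ hdiff z h) fun z h h' ↦ by
      refine (hbound z h).trans ?_
      gcongr
  have hne : ∀ (n : ℕ) (w : ℂ), n ≠ 0 →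
      (n : ℂ) ^ (-s₀) * (n : ℂ) ^ (-w) = (n : ℂ) ^ (-(s₀ + w)) := by
    intro n w hn
    rw [neg_add s₀ w, cpow_add _ _ (by exact_mod_cast hn)]
  have hperron := two_pi_mul_sum_eq_integral one_pos le_rfl
    (a := fun n ↦ ((ArithmeticFunction.liouville n : ℤ) : ℂ) * (n : ℂ) ^ (-s₀)) (by simp) ?_ hN
  · have hser : ∀ y : ℝ, ∑' n : ℕ, ((ArithmeticFunction.liouville n : ℤ) : ℂ) * (n : ℂ) ^ (-s₀) *
        (n : ℂ) ^ (-(((1 : ℝ) : ℂ) + y * I)) = liouvilleZeta (s₀ + (((1 : ℝ) : ℂ) + y * I)) := by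
      intro y
      rw [← tsum_liouville_eq (by rw [add_re, hs₀re]; simp)]
      congr with n
      rcases eq_or_ne n 0 with rfl | hn
      · simp
      · rw [mul_assoc, hne n _ hn]
    simp_rw [hser] at hperron
    rw [← hshift] at hperron
    set S := ∑ n ∈ Finset.Icc 1 N,
      ((ArithmeticFunction.liouville n : ℤ) : ℂ) * (n : ℂ) ^ (-s₀) with hS
    have h1 : ‖2 * (Real.pi : ℂ) * S‖ ≤
        C * (8 / δ) * (1 + |t|) ^ ε * ((N : ℝ) + 1) ^ ε * J := by
      rw [hperron, hJ, ← integral_const_mul]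
      refine norm_integral_le_of_norm_le (hJi.const_mul _) (Eventually.of_forall fun y ↦ ?_)
      have h := hbound (δ + y * I) (by simp)
      rw [re_ofReal_add_ofReal_mul_I, im_ofReal_add_ofReal_mul_I,
        show δ + δ = ε by rw [hδ]; ring] at h
      exact h
    have h2 : ‖S‖ ≤ ‖2 * (Real.pi : ℂ) * S‖ := by
      rw [norm_mul]
      refine le_mul_of_one_le_left (norm_nonneg _) ?_
      rw [norm_mul, Complex.norm_real, Real.norm_of_nonneg Real.pi_pos.le, Complex.norm_ofNat]
      linarith [Real.pi_gt_three]
    calc ‖S‖ ≤ _ := h2.trans h1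
      _ ≤ C * (8 / δ) * (1 + |t|) ^ ε * ((N : ℝ) + 1) ^ ε * (J + 1) := by gcongr; linarith
      _ = _ := by ring
  · refine (Real.summable_nat_rpow_inv.mpr (show (1 : ℝ) < 3 / 2 by norm_num)).of_nonneg_of_le
      (fun n ↦ by positivity) fun n ↦ ?_
    rcases eq_or_ne n 0 with rfl | hn
    · simp
    have hn0 : (0 : ℝ) < n := by positivity
    rw [norm_mul, norm_natCast_cpow_of_pos (Nat.pos_of_ne_zero hn), neg_re, hs₀re, mul_assoc,
      ← Real.rpow_add hn0, ← Real.rpow_neg hn0.le, show -(1 / 2 : ℝ) + -1 = -(3 / 2) by norm_num]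
    exact mul_le_of_le_one_left (by positivity) (norm_liouville_le n)

end LiouvilleSums

/-! ### From partial sums to the interval from `X` to `2X` -/

theorem lemma2p3 (hRH : RiemannHypothesis) (ε : ℝ) (hε : 0 < ε) :
    ∃ C : ℝ, 0 < C ∧ ∀ X : ℝ, 0 < X → ∀ t : ℝ,
      ‖∑ n ∈ Finset.Icc ⌈X⌉₊ ⌊2 * X⌋₊,
          ((ArithmeticFunction.liouville n : ℤ) : ℂ) /
            (n : ℂ) ^ ((1 / 2 : ℂ) + Complex.I * (t : ℂ))‖
        ≤ C * (1 + |t|) ^ ε * X ^ ε := by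
  -- The partial sum bound needs an exponent at most `1`; the bases below are at least `1`, so `ε'`
  -- may be raised to `ε`.
  set ε' : ℝ := min ε 1 with hε'
  have hε'0 : 0 < ε' := by positivity
  obtain ⟨C, hC, h⟩ := exists_norm_sum_liouville_le hRH hε'0 (min_le_right _ _)
  refine ⟨2 * C * 4 ^ ε, by positivity, fun X hX t ↦ ?_⟩
  simp_rw [div_eq_mul_inv _ ((_ : ℂ) ^ (_ : ℂ)), ← Complex.cpow_neg]
  set f : ℕ → ℂ := fun n ↦ ((ArithmeticFunction.liouville n : ℤ) : ℂ) *
    (n : ℂ) ^ (-((1 / 2 : ℂ) + Complex.I * (t : ℂ))) with hf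
  change ‖∑ n ∈ Finset.Icc ⌈X⌉₊ ⌊2 * X⌋₊, f n‖ ≤ _
  -- For `X < 1/2` the sum is empty. Otherwise `N + 1 ≤ 2X + 1 ≤ 4X`, the source of `4 ^ ε`; the
  -- factor `2` counts the two partial sums subtracted.
  rcases lt_or_ge X (1 / 2) with hX2 | hX2
  · have h1 : ⌊2 * X⌋₊ = 0 := Nat.floor_eq_zero.mpr (by linarith)
    have h2 : 0 < ⌈X⌉₊ := Nat.ceil_pos.mpr hX
    rw [h1, Finset.Icc_eq_empty_of_lt h2, Finset.sum_empty, norm_zero]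
    positivity
  have hle : ∀ N : ℕ, (N : ℝ) ≤ 2 * X →
      ‖∑ n ∈ Finset.Icc 1 N, f n‖ ≤ C * (1 + |t|) ^ ε * (4 ^ ε * X ^ ε) := by
    intro N hN
    refine (h N t).trans ?_
    rw [← Real.mul_rpow (by norm_num) hX.le]
    gcongr ?_ * ?_ * ?_
    · exact Real.rpow_le_rpow_of_exponent_le (by linarith [abs_nonneg t]) (min_le_left _ _)
    · calc ((N : ℝ) + 1) ^ ε' ≤ (4 * X) ^ ε' := by gcongr; linarith
        _ ≤ (4 * X) ^ ε :=
          Real.rpow_le_rpow_of_exponent_le (by linarith) (min_le_left _ _)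
  have hceil : 1 ≤ ⌈X⌉₊ := Nat.ceil_pos.mpr hX
  have hm : ((⌈X⌉₊ - 1 : ℕ) : ℝ) ≤ 2 * X := by
    rw [Nat.cast_sub hceil]
    have := Nat.ceil_lt_add_one hX.le
    push_cast
    linarith
  have hm' : ⌈X⌉₊ - 1 ≤ ⌊2 * X⌋₊ := Nat.le_floor hm
  have hsplit : ∑ n ∈ Finset.Icc ⌈X⌉₊ ⌊2 * X⌋₊, f n =
      ∑ n ∈ Finset.Icc 1 ⌊2 * X⌋₊, f n - ∑ n ∈ Finset.Icc 1 (⌈X⌉₊ - 1), f n := by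
    rw [eq_sub_iff_add_eq', ← Finset.sum_union]
    · congr 1
      ext n
      simp only [Finset.mem_union, Finset.mem_Icc]
      omega
    · rw [Finset.disjoint_left]
      intro n
      simp only [Finset.mem_Icc]
      omega
  rw [hsplit]
  refine (norm_sub_le _ _).trans ?_
  have h1 := hle _ (Nat.floor_le (by positivity : (0 : ℝ) ≤ 2 * X))
  have h2 := hle _ hm
  linarith
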